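/- Let $s$ be a positive integer, let $\alpha\in\mathbf{F}_{2^s}^*$, and for a polynomial $f\in\mathbf{F}_{2^s}[x]$ of positive degree $m$ put $f^{(Q,\alpha)}(x)=x^m f(x+\alpha x^{-1})\in\mathbf{F}_{2^s}[x]$. Let $\theta_\alpha$ be the map on $\overline{\mathbf{F}}_{2^s}\cup\{\infty\}$ (where $\overline{\mathbf{F}}_{2^s}$ is an algebraic closure of $\mathbf{F}_{2^s}$) with $\theta_\alpha(0)=\theta_\alpha(\infty)=\infty$ and $\theta_\alpha(x)=x+\alpha x^{-1}$ otherwise; an element $\beta$ is called $\theta_\alpha$-periodic if $\theta_\alpha^k(\beta)=\beta$ for some positive integer $k$. Let $f_0\in\mathbf{F}_{2^s}[x]$ be an irreducible monic polynomial of positive degree $n$, and let $2^{l_s}$ and $2^{l_n}$ be the greatest powers of $2$ dividing $s$ and $n$ respectively. Let $f_1$ be an irreducible monic factor of $f_0^{(Q,\alpha)}$ none of whose roots is $\theta_\alpha$-periodic, and for each $i\ge 2$ let $f_i$ be any irreducible monic factor of $f_{i-1}^{(Q,\alpha)}$. Then there exists a positive integer $t\le l_s+l_n+3$ such that $\deg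 f_t=2n$ and $\deg f_{t+1}=4n$. Moreover, for this $t$ and for every $i\ge t$, the polynomial $f_i^{(Q,\alpha)}$ is irreducible in $\mathbf{F}_{2^s}[x]$ and $\deg f_{i+1}=2\deg f_i$. -/

import Mathlib

open Polynomial

/-- The `(Q, a)`-transform `x ^ n * f (x + a * x⁻¹)` of a polynomial `f` of degree `n`, written as a
polynomial: the term `c x ^ k` of `f` contributes `c * (x ^ 2 + a) ^ k * x ^ (n - k)`. -/
noncomputable def qTransform {F : Type*} [Field F] (a : F) (f : F[X]) : F[X] :=
  f.sum fun k c => C c * (X ^ 2 + C a) ^ k * X ^ (f.natDegree - k)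

/-- In the field of rational functions, `qTransform a f` is `x ^ n * f (x + a * x⁻¹)`. -/
theorem qTransform_eq {F : Type*} [Field F] (a : F) (f : F[X]) :
    algebraMap F[X] (RatFunc F) (qTransform a f) =
      RatFunc.X ^ f.natDegree * aeval (RatFunc.X + RatFunc.C a * RatFunc.X⁻¹) f := by
  have hX : (RatFunc.X : RatFunc F) ≠ 0 := RatFunc.X_ne_zero
  rw [qTransform, aeval_eq_sum_range' (Nat.lt_succ_self _), sum_over_range _ (by simp), map_sum,
    Finset.mul_sum]
  refine Finset.sum_congr rfl fun k hk => ?_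
  have hk' : k ≤ f.natDegree := Nat.lt_succ_iff.mp (Finset.mem_range.mp hk)
  have h : (RatFunc.X ^ 2 + RatFunc.C a : RatFunc F) =
      RatFunc.X * (RatFunc.X + RatFunc.C a * RatFunc.X⁻¹) := by
    field_simp
  simp only [map_mul, map_pow, map_add, RatFunc.algebraMap_C, RatFunc.algebraMap_X]
  rw [h, mul_pow, ← Nat.sub_add_cancel hk', pow_add, Nat.sub_add_cancel hk', Algebra.smul_def,
    RatFunc.algebraMap_eq_C]
  ring

open Classical in
/-- The map `θ_a` on the projective line `K ∪ {∞}`: it sends `0` and `∞` to `∞`, and every other `x`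
to `x + a * x⁻¹`. -/
noncomputable def theta {K : Type*} [Field K] (a : K) (x : OnePoint K) : OnePoint K :=
  x.elim OnePoint.infty fun y => if y = 0 then OnePoint.infty else ((y + a * y⁻¹ : K) : OnePoint K)

/-!
After rescaling by a square root of `α` we may take `α = 1`. Choose roots `x i` of `f i` such that
`θ (x (i + 1)) = x i`, so that `deg f i` is the degree of `x i`, and put `M = 2 s n`.

In characteristic two, `y + y⁻¹ = x` is an Artin–Schreier equation, solvable in the field `𝔽` with
`2 ^ m` elements iff the trace of `x⁻¹` vanishes. If `x` and `x⁻¹` both have trace one in `𝔽`, then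
so do `y` and `y⁻¹` in the quadratic extension of `𝔽`; from such an `x` on, the degree therefore
doubles at every step. Let `x t` be the last element of the tower in the field with `2 ^ M`
elements. The trace of `(x t)⁻¹` there is one because `x (t + 1)` lies outside, and that of
`x t + (x t)⁻¹ = x (t - 1)` is zero, because `x 0` lies in the subfield of index two and `x t` lies
inside. So the doubling starts at `x t`.

The bound on `t` comes from the curve `y ^ 2 + x y = x ^ 3 + 1`, on which the abscissa of `2 P` is
`θ (x(P)) ^ 2`. The trace condition on `x t` makes it the abscissa of a point `P` over the field
with `2 ^ M` elements. As `x 1` is not periodic, `2 ^ (t - 1) P` has even order, so some multiple of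
`P` has order `2 ^ t`. The abscissa of that multiple is mapped to `0` by `θ ^ (t - 1)`, hence
generates the field with `2 ^ 2 ^ (t - 2)` elements, and `2 ^ (t - 2)` divides `M`.
-/

section Dynamics

variable {A B : Type*}

theorem mem_periodicPts_of_comp {g h : A → A} (hgh : Function.Commute h g) {m : ℕ} (hm : 0 < m)
    (hg : ∀ x, Function.IsPeriodicPt g m x) {x : A} (hx : x ∈ Function.periodicPts (h ∘ g)) :
    x ∈ Function.periodicPts h := by
  obtain ⟨n, hn, hx⟩ := hx
  exact ⟨n * m, Nat.mul_pos hn hm, (hx.mul_const m).left_of_comp hgh ((hg x).const_mul n)⟩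

theorem mem_periodicPts_of_semiconj_of_injective {g : A → B} (hg : Function.Injective g) {h : A → A}
    {k : B → B} (hgk : Function.Semiconj g h k) {x : A} (hx : g x ∈ Function.periodicPts k) :
    x ∈ Function.periodicPts h := by
  obtain ⟨n, hn, hx⟩ := hx
  exact ⟨n, hn, hg (((hgk.iterate_right n) x).trans hx)⟩

end Dynamics

section AddOrder

variable {G : Type*} [AddMonoid G] {p : ℕ} {x : G}

theorem mem_periodicPts_nsmul (hx : IsOfFinAddOrder x) (hp : p.Coprime (addOrderOf x)) :
    x ∈ Function.periodicPts (p • · : G → G) := by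
  refine ⟨(addOrderOf x).totient, Nat.totient_pos.mpr hx.addOrderOf_pos, ?_⟩
  rw [Function.IsPeriodicPt, Function.IsFixedPt, smul_iterate_apply, ← mod_addOrderOf_nsmul,
    Nat.ModEq.pow_totient hp, mod_addOrderOf_nsmul, one_nsmul]

theorem coprime_addOrderOf_or_exists_addOrderOf_eq (hp : p.Prime) (hx : IsOfFinAddOrder x)
    (n : ℕ) : p.Coprime (addOrderOf (p ^ n • x)) ∨ ∃ k : ℕ, addOrderOf (k • x) = p ^ (n + 1) := by
  by_cases hdvd : p ^ (n + 1) ∣ addOrderOf x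
  · exact .inr ⟨_, addOrderOf_nsmul_addOrderOf_sub hx.addOrderOf_pos.ne' hdvd⟩
  · obtain ⟨e, m, hpm, hm⟩ := Nat.exists_eq_pow_mul_and_not_dvd hx.addOrderOf_pos.ne' p hp.ne_one
    have he : e ≤ n := by
      by_contra! hne
      exact hdvd (hm ▸ (pow_dvd_pow p hne).mul_right m)
    refine .inl (((hp.coprime_iff_not_dvd).mpr hpm).of_dvd_right ?_)
    rw [addOrderOf_dvd_iff_nsmul_eq_zero, ← mul_nsmul', ← addOrderOf_dvd_iff_nsmul_eq_zero, hm,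
      mul_comm m]
    exact Nat.mul_dvd_mul_right (pow_dvd_pow p he) m

end AddOrder

section TraceSum

variable {K : Type*} [Field K]

/-- The sum `x + x ^ 2 + ⋯ + x ^ (2 ^ (m - 1))`, which on the field with `2 ^ m` elements is the
absolute trace. Membership of `x` in that field is written `x ^ 2 ^ m = x`. -/
def traceSum (m : ℕ) (x : K) : K := ∑ i ∈ Finset.range m, x ^ 2 ^ i

theorem traceSum_two_mul (m : ℕ) (x : K) :
    traceSum (2 * m) x = traceSum m x + traceSum m (x ^ 2 ^ m) := by
  simp only [traceSum, two_mul, Finset.sum_range_add, ← pow_mul, ← pow_add]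

/-- `x` lies in the field with `2 ^ m` elements, and both `x` and `x⁻¹` have trace one there. -/
structure IsTraceOne (m : ℕ) (x : K) : Prop where
  pow_eq : x ^ 2 ^ m = x
  traceSum_eq : traceSum m x = 1
  traceSum_inv_eq : traceSum m x⁻¹ = 1

theorem IsTraceOne.ne_zero {m : ℕ} {x : K} (h : IsTraceOne m x) : x ≠ 0 := by
  rintro rfl
  simpa [traceSum] using h.traceSum_eq

theorem eq_or_eq_inv_of_add_inv_eq {x y : K} (hx : x ≠ 0) (hy : y ≠ 0) (h : x + x⁻¹ = y + y⁻¹) :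
    x = y ∨ x = y⁻¹ := by
  have hfactor : (x - y) * (x * y - 1) = 0 := by
    field_simp at h
    linear_combination h
  exact (mul_eq_zero.mp hfactor).imp sub_eq_zero.mp
    fun hxy => eq_inv_of_mul_eq_one_left (sub_eq_zero.mp hxy)

variable [CharP K 2] {m : ℕ} {x y : K}

theorem isPeriodicPt_frobenius_two_iff :
    Function.IsPeriodicPt (frobenius K 2) m x ↔ x ^ 2 ^ m = x := by
  rw [Function.IsPeriodicPt, Function.IsFixedPt, iterate_frobenius]

theorem add_inv_pow_two_pow (m : ℕ) (x : K) : (x + x⁻¹) ^ 2 ^ m = x ^ 2 ^ m + (x ^ 2 ^ m)⁻¹ := by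
  rw [add_pow_char_pow, inv_pow]

theorem traceSum_add (m : ℕ) (x y : K) : traceSum m (x + y) = traceSum m x + traceSum m y := by
  simp only [traceSum, add_pow_char_pow, Finset.sum_add_distrib]

theorem traceSum_sq_add_self (m : ℕ) (x : K) : traceSum m (x ^ 2 + x) = x ^ 2 ^ m + x := by
  induction m with
  | zero => simp [traceSum, CharTwo.add_self_eq_zero]
  | succ m ih =>
    rw [traceSum, Finset.sum_range_succ, ← traceSum, ih, add_pow_char_pow, ← pow_mul, ← pow_succ']
    linear_combination CharTwo.add_self_eq_zero (x ^ 2 ^ m)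

theorem traceSum_sq (hx : x ^ 2 ^ m = x) : traceSum m (x ^ 2) = traceSum m x := by
  have h := traceSum_sq_add_self m x
  rwa [traceSum_add, hx, CharTwo.add_self_eq_zero, CharTwo.add_eq_zero] at h

theorem traceSum_two_mul_eq_zero (hx : x ^ 2 ^ m = x) : traceSum (2 * m) x = 0 := by
  rw [traceSum_two_mul, hx, CharTwo.add_self_eq_zero]

theorem traceSum_eq_zero_or_one (hx : x ^ 2 ^ m = x) : traceSum m x = 0 ∨ traceSum m x = 1 := by
  have hsq : traceSum m x ^ 2 = traceSum m x := by
    conv_rhs => rw [← traceSum_sq hx]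
    rw [traceSum, traceSum, CharTwo.sum_sq]
    exact Finset.sum_congr rfl fun i _ => pow_right_comm ..
  exact eq_zero_or_one_of_sq_eq_self hsq

theorem pow_two_pow_eq_or_eq_inv (hx : (x + x⁻¹) ^ 2 ^ m = x + x⁻¹) :
    x ^ 2 ^ m = x ∨ x ^ 2 ^ m = x⁻¹ := by
  rcases eq_or_ne x 0 with rfl | hx0
  · simp
  · exact eq_or_eq_inv_of_add_inv_eq (pow_ne_zero _ hx0) hx0 (add_inv_pow_two_pow m x ▸ hx)

theorem pow_two_pow_two_mul_eq (hx : (x + x⁻¹) ^ 2 ^ m = x + x⁻¹) : x ^ 2 ^ (2 * m) = x := by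
  rw [two_mul, pow_add, pow_mul]
  rcases pow_two_pow_eq_or_eq_inv hx with h | h
  · rw [h, h]
  · rw [h, inv_pow, h, inv_inv]

theorem traceSum_inv_eq_zero_iff (hxy : y + y⁻¹ = x) (hx0 : x ≠ 0) (hx : x ^ 2 ^ m = x) :
    traceSum m x⁻¹ = 0 ↔ y ^ 2 ^ m = y := by
  have hy0 : y ≠ 0 := by
    rintro rfl
    simp [← hxy] at hx0
  -- Dividing `y ^ 2 + x y + 1 = 0` by `x ^ 2` puts it in Artin–Schreier form.
  have hartinSchreier : (y / x) ^ 2 + y / x = x⁻¹ ^ 2 := by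
    have hquad : x * y = y ^ 2 + 1 := by
      rw [← hxy]
      field_simp
    field_simp
    linear_combination hquad + CharTwo.add_self_eq_zero (y ^ 2)
  have hinv : x⁻¹ ^ 2 ^ m = x⁻¹ := by rw [inv_pow, hx]
  rw [← traceSum_sq hinv, ← hartinSchreier, traceSum_sq_add_self, div_pow, hx, ← add_div,
    div_eq_zero_iff, or_iff_left hx0, CharTwo.add_eq_zero]

namespace IsTraceOne

theorem pow_ne (h : IsTraceOne m x) (hxy : y + y⁻¹ = x) : y ^ 2 ^ m ≠ y := fun hy => by
  simpa [(traceSum_inv_eq_zero_iff hxy h.ne_zero h.pow_eq).mpr hy] using h.traceSum_inv_eq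

theorem two_mul (h : IsTraceOne m x) (hxy : y + y⁻¹ = x) : IsTraceOne (2 * m) y := by
  have hx := h.pow_eq
  rw [← hxy] at hx
  have hy : y ^ 2 ^ m = y⁻¹ := (pow_two_pow_eq_or_eq_inv hx).resolve_left (h.pow_ne hxy)
  refine ⟨pow_two_pow_two_mul_eq hx, ?_, ?_⟩
  · rw [traceSum_two_mul, hy, ← traceSum_add, hxy, h.traceSum_eq]
  · rw [traceSum_two_mul, inv_pow, hy, inv_inv, ← traceSum_add, add_comm, hxy, h.traceSum_eq]

theorem pow_half_ne (h : IsTraceOne (2 * m) x) : x ^ 2 ^ m ≠ x := fun hx =>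
  zero_ne_one ((traceSum_two_mul_eq_zero hx).symm.trans h.traceSum_eq)

theorem two_pow_dvd {k : ℕ} (h : IsTraceOne (2 ^ k) x) (hx : x ^ 2 ^ m = x) : 2 ^ k ∣ m := by
  cases k with
  | zero => exact one_dvd m
  | succ k =>
    have hhalf : ¬ Function.IsPeriodicPt (frobenius K 2) (2 ^ k) x := by
      rw [isPeriodicPt_frobenius_two_iff]
      exact pow_half_ne (pow_succ' 2 k ▸ h)
    rw [← Function.minimalPeriod_eq_prime_pow hhalf (isPeriodicPt_frobenius_two_iff.mpr h.pow_eq)]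
    exact (isPeriodicPt_frobenius_two_iff.mpr hx).minimalPeriod_dvd

end IsTraceOne

end TraceSum

section Theta

variable {K : Type*} [Field K]

theorem theta_infty (a : K) : theta a OnePoint.infty = OnePoint.infty :=
  rfl

theorem theta_coe_zero (a : K) : theta a ((0 : K) : OnePoint K) = OnePoint.infty := by
  simp [theta]

theorem theta_coe (a : K) {x : K} (hx : x ≠ 0) :
    theta a (x : OnePoint K) = ((x + a * x⁻¹ : K) : OnePoint K) := by
  simp [theta, hx]

theorem theta_coe_eq_coe_iff {a x y : K} :
    theta a (y : OnePoint K) = (x : OnePoint K) ↔ y ≠ 0 ∧ y + a * y⁻¹ = x := by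
  rcases eq_or_ne y 0 with rfl | hy
  · simp [theta_coe_zero]
  · rw [theta_coe a hy, OnePoint.coe_eq_coe, and_iff_right hy]

theorem theta_one_coe_eq_coe_iff {x y : K} :
    theta 1 (y : OnePoint K) = (x : OnePoint K) ↔ y ≠ 0 ∧ y + y⁻¹ = x := by
  rw [theta_coe_eq_coe_iff, one_mul]

theorem eq_zero_of_theta_eq_infty {a : K} {x : OnePoint K} (hx : x ≠ OnePoint.infty)
    (h : theta a x = OnePoint.infty) : x = ((0 : K) : OnePoint K) := by
  obtain ⟨y, rfl⟩ := OnePoint.ne_infty_iff_exists.mp hx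
  by_contra hy
  rw [theta_coe a fun hy0 => hy (congrArg _ hy0)] at h
  exact OnePoint.coe_ne_infty _ h

theorem exists_coe_of_theta_iterate_eq_coe {a z : K} {k : ℕ} {x : OnePoint K}
    (h : (theta a)^[k] x = (z : OnePoint K)) : ∃ y : K, (y : OnePoint K) = x := by
  refine OnePoint.ne_infty_iff_exists.mp ?_
  rintro rfl
  rw [Function.iterate_fixed (theta_infty a)] at h
  exact OnePoint.infty_ne_coe z h

theorem theta_iterate_tower {a : K} {x : ℕ → K}
    (hx : ∀ i, theta a (x (i + 1) : OnePoint K) = (x i : OnePoint K)) (N i : ℕ) :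
    (theta a)^[N] (x (i + N) : OnePoint K) = (x i : OnePoint K) := by
  induction N with
  | zero => rfl
  | succ N ih => rw [Function.iterate_succ_apply, ← add_assoc, hx, ih]

theorem map_theta {L : Type*} [Field L] (φ : K →+* L) (a : K) :
    Function.Semiconj (OnePoint.map φ) (theta a) (theta (φ a)) := by
  intro x
  induction x using OnePoint.rec with
  | infty => rfl
  | coe x =>
    rcases eq_or_ne x 0 with rfl | hx
    · simp [theta_coe_zero]
    · rw [theta_coe a hx, OnePoint.map_some, OnePoint.map_some,
        theta_coe _ ((map_ne_zero φ).mpr hx), map_add, map_mul, map_inv₀]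

theorem map_theta_one {L : Type*} [Field L] (φ : K →+* L) :
    Function.Semiconj (OnePoint.map φ) (theta 1) (theta 1) := by
  simpa only [map_one] using map_theta φ 1

theorem map_mul_theta {c : K} (hc : c ≠ 0) (a : K) :
    Function.Semiconj (OnePoint.map (c * ·)) (theta a) (theta (c ^ 2 * a)) := by
  intro x
  induction x using OnePoint.rec with
  | infty => rfl
  | coe x =>
    rcases eq_or_ne x 0 with rfl | hx
    · simp [theta_coe_zero]
    · rw [theta_coe a hx, OnePoint.map_some, OnePoint.map_some, theta_coe _ (mul_ne_zero hc hx)]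
      congr 1
      field_simp

theorem isTraceOne_of_theta_iterate_eq_zero [CharP K 2] {k : ℕ} {x : K}
    (h : (theta 1)^[k + 1] (x : OnePoint K) = ((0 : K) : OnePoint K)) : IsTraceOne (2 ^ k) x := by
  induction k generalizing x with
  | zero =>
    obtain ⟨hx0, hx⟩ := theta_one_coe_eq_coe_iff.mp h
    obtain rfl : x = 1 := by
      rw [CharTwo.add_eq_zero] at hx
      rw [← CharTwo.sq_inj, one_pow, sq]
      nth_rw 2 [hx]
      exact mul_inv_cancel₀ hx0
    constructor <;> simp [traceSum]
  | succ k ih =>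
    rw [Function.iterate_succ_apply] at h
    obtain ⟨y, hy⟩ := exists_coe_of_theta_iterate_eq_coe h
    rw [← hy] at h
    exact pow_succ' 2 k ▸ (ih h).two_mul (theta_one_coe_eq_coe_iff.mp hy.symm).2

end Theta

theorem finite_of_forall_pow_eq_self {K : Type*} [Field K] {q : ℕ} (hq : 1 < q)
    (hK : ∀ x : K, x ^ q = x) : Finite K := by
  refine Set.finite_univ_iff.mp ((rootSet_finite (X ^ q - X : K[X]) K).subset fun x _ => ?_)
  rw [mem_rootSet]
  exact ⟨FiniteField.X_pow_card_sub_X_ne_zero K hq, by simp [hK x]⟩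

section Curve

variable (K : Type*) [Field K]

/-- The curve `y ^ 2 + x y = x ^ 3 + 1`. In characteristic two, doubling its points induces the
square of `theta 1` on abscissas. -/
def koblitzCurve : WeierstrassCurve.Affine K :=
  { a₁ := 1, a₂ := 0, a₃ := 0, a₄ := 0, a₆ := 1 }

variable {K}

/-- The `x`-coordinate of a point of the curve, in the projective line. -/
def abscissa : (koblitzCurve K).Point → OnePoint K
  | .zero => OnePoint.infty
  | .some x _ _ => (x : OnePoint K)

theorem abscissa_eq_infty_iff {P : (koblitzCurve K).Point} :
    abscissa P = OnePoint.infty ↔ P = 0 := by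
  cases P with
  | zero => exact ⟨fun _ => rfl, fun _ => rfl⟩
  | some x y h => exact ⟨fun h => (OnePoint.coe_ne_infty _ h).elim, fun h => by cases h⟩

theorem koblitzCurve_equation_iff {x y : K} :
    (koblitzCurve K).Equation x y ↔ y ^ 2 + x * y = x ^ 3 + 1 := by
  simp [WeierstrassCurve.Affine.equation_iff, koblitzCurve]

theorem finite_koblitzCurve_point [Finite K] : Finite (koblitzCurve K).Point := by
  let coordinates : (koblitzCurve K).Point → Option (K × K)
    | .zero => none
    | .some x y _ => some (x, y)
  refine Finite.of_injective coordinates fun P Q h => ?_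
  cases P <;> cases Q <;> simp_all [coordinates]

variable [CharP K 2]

theorem exists_abscissa_eq {x y : K} (hx : x ≠ 0) (h : y ^ 2 + x * y = x ^ 3 + 1) :
    ∃ P : (koblitzCurve K).Point, abscissa P = (x : OnePoint K) := by
  refine ⟨.some x y ?_, rfl⟩
  rw [WeierstrassCurve.Affine.nonsingular_iff]
  refine ⟨koblitzCurve_equation_iff.mpr h, Or.inr fun hy => hx ?_⟩
  simp only [koblitzCurve] at hy
  linear_combination hy - CharTwo.add_self_eq_zero y

/-- The map `x ↦ (x + x⁻¹) ^ 2` on the projective line, the effect on abscissas of doubling a point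
of `koblitzCurve`. -/
noncomputable def thetaSq : OnePoint K → OnePoint K :=
  theta 1 ∘ OnePoint.map (frobenius K 2)

theorem commute_theta_map_frobenius :
    Function.Commute (theta (1 : K)) (OnePoint.map (frobenius K 2)) :=
  Function.Commute.symm (map_theta_one (frobenius K 2))

theorem map_frobenius_injective : Function.Injective (OnePoint.map (frobenius K 2)) :=
  Option.map_injective (frobenius_inj K 2)

theorem thetaSq_iterate (k : ℕ) (x : OnePoint K) :
    thetaSq^[k] x = (OnePoint.map (frobenius K 2))^[k] ((theta 1)^[k] x) := by
  rw [thetaSq, commute_theta_map_frobenius.comp_iterate]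
  exact commute_theta_map_frobenius.iterate_iterate k k x

theorem thetaSq_iterate_eq_infty_iff {k : ℕ} {x : OnePoint K} :
    thetaSq^[k] x = OnePoint.infty ↔ (theta 1)^[k] x = OnePoint.infty := by
  rw [thetaSq_iterate]
  conv_lhs => rw [← Function.iterate_fixed (OnePoint.map_infty (frobenius K 2)) k]
  exact (map_frobenius_injective.iterate k).eq_iff

theorem isPeriodicPt_map_frobenius {m : ℕ} (hK : ∀ x : K, x ^ 2 ^ m = x) (x : OnePoint K) :
    Function.IsPeriodicPt (OnePoint.map (frobenius K 2)) m x := by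
  induction x using OnePoint.rec with
  | infty => exact Function.iterate_fixed rfl m
  | coe x => exact (isPeriodicPt_frobenius_two_iff.mpr (hK x)).map fun _ => rfl

theorem theta_iterate_mem_periodicPts_of_thetaSq {m : ℕ} (hm : 0 < m)
    (hK : ∀ x : K, x ^ 2 ^ m = x) {N : ℕ} {x : OnePoint K}
    (hx : thetaSq^[N] x ∈ Function.periodicPts (thetaSq : OnePoint K → OnePoint K)) :
    (theta 1)^[N] x ∈ Function.periodicPts (theta (1 : K)) := by
  have hcomp := mem_periodicPts_of_comp commute_theta_map_frobenius hm
    (isPeriodicPt_map_frobenius hK) hx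
  rw [thetaSq_iterate] at hcomp
  exact mem_periodicPts_of_semiconj_of_injective (map_frobenius_injective.iterate N)
    (commute_theta_map_frobenius.symm.iterate_left N) hcomp

section GroupLaw

variable [DecidableEq K]

theorem abscissa_two_nsmul (P : (koblitzCurve K).Point) :
    abscissa (2 • P) = thetaSq (abscissa P) := by
  rw [two_nsmul]
  cases P with
  | zero => rfl
  | some x y h =>
    have heq := koblitzCurve_equation_iff.mp h.1
    have hnegY : (koblitzCurve K).negY x y = y + x := by
      simp [koblitzCurve, WeierstrassCurve.Affine.negY, CharTwo.neg_eq, CharTwo.sub_eq_add]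
    rcases eq_or_ne x 0 with rfl | hx
    · rw [WeierstrassCurve.Affine.Point.add_self_of_Y_eq (by rw [hnegY, add_zero])]
      simp [thetaSq, abscissa, theta_coe_zero]
    · have hy : y ≠ (koblitzCurve K).negY x y := by simpa only [hnegY, ne_eq, left_eq_add] using hx
      have hslope : (koblitzCurve K).slope x x y y = (x ^ 2 + y) / x := by
        rw [WeierstrassCurve.Affine.slope_of_Y_ne rfl hy, hnegY,
          show y - (y + x) = x by rw [CharTwo.sub_eq_add, CharTwo.add_cancel_left]]
        congr 1
        simp only [koblitzCurve]
        linear_combination (x ^ 2 - y) * CharTwo.two_eq_zero (R := K)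
      rw [WeierstrassCurve.Affine.Point.add_self_of_Y_ne hy]
      simp only [abscissa, thetaSq, Function.comp_apply, OnePoint.map_some, frobenius_def,
        theta_coe 1 (pow_ne_zero 2 hx), hslope]
      congr 1
      simp only [WeierstrassCurve.Affine.addX, koblitzCurve]
      field_simp
      linear_combination heq + x ^ 2 * y * CharTwo.two_eq_zero (R := K)

theorem abscissa_two_pow_nsmul (k : ℕ) (P : (koblitzCurve K).Point) :
    abscissa (2 ^ k • P) = thetaSq^[k] (abscissa P) := by
  rw [← smul_iterate_apply]
  exact (Function.Semiconj.iterate_right abscissa_two_nsmul k) P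

theorem theta_iterate_abscissa_eq_infty_iff {k : ℕ} {P : (koblitzCurve K).Point} :
    (theta 1)^[k] (abscissa P) = OnePoint.infty ↔ addOrderOf P ∣ 2 ^ k := by
  rw [← thetaSq_iterate_eq_infty_iff, ← abscissa_two_pow_nsmul, abscissa_eq_infty_iff,
    addOrderOf_dvd_iff_nsmul_eq_zero]

theorem theta_iterate_abscissa_eq_zero {k : ℕ} {P : (koblitzCurve K).Point}
    (hP : addOrderOf P = 2 ^ (k + 1)) :
    (theta 1)^[k] (abscissa P) = ((0 : K) : OnePoint K) := by
  refine eq_zero_of_theta_eq_infty (a := 1) ?_ ?_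
  · rw [Ne, theta_iterate_abscissa_eq_infty_iff, hP, Nat.pow_dvd_pow_iff_le_right one_lt_two]
    exact Nat.not_succ_le_self k
  · rw [← Function.iterate_succ_apply' (theta 1), theta_iterate_abscissa_eq_infty_iff, hP]

theorem le_padicValNat_add_one_of_addOrderOf_eq {m : ℕ} (hm : m ≠ 0) (hK : ∀ x : K, x ^ 2 ^ m = x)
    {N : ℕ} {P : (koblitzCurve K).Point} (hP : addOrderOf P = 2 ^ (N + 1)) :
    N ≤ padicValNat 2 m + 1 := by
  cases N with
  | zero => exact Nat.zero_le _
  | succ k =>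
    have hzero := theta_iterate_abscissa_eq_zero hP
    obtain ⟨x, hx⟩ := exists_coe_of_theta_iterate_eq_coe hzero
    rw [← hx] at hzero
    have hdvd := (isTraceOne_of_theta_iterate_eq_zero hzero).two_pow_dvd (hK x)
    exact Nat.succ_le_succ ((padicValNat_dvd_iff_le hm).mp hdvd)

theorem theta_iterate_abscissa_mem_periodicPts {m : ℕ} (hm : 0 < m) (hK : ∀ x : K, x ^ 2 ^ m = x)
    {N : ℕ} {P : (koblitzCurve K).Point} (hP : IsOfFinAddOrder P)
    (hodd : Nat.Coprime 2 (addOrderOf (2 ^ N • P))) :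
    (theta 1)^[N] (abscissa P) ∈ Function.periodicPts (theta (1 : K)) := by
  refine theta_iterate_mem_periodicPts_of_thetaSq hm hK ?_
  rw [← abscissa_two_pow_nsmul]
  exact Function.Semiconj.mapsTo_periodicPts abscissa_two_nsmul
    (mem_periodicPts_nsmul hP.nsmul hodd)

end GroupLaw

theorem le_padicValNat_add_one_of_notMem_periodicPts {m : ℕ} (hm : m ≠ 0)
    (hK : ∀ x : K, x ^ 2 ^ m = x) {N : ℕ} (P : (koblitzCurve K).Point)
    (hper : (theta 1)^[N] (abscissa P) ∉ Function.periodicPts (theta (1 : K))) :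
    N ≤ padicValNat 2 m + 1 := by
  classical
  have := finite_of_forall_pow_eq_self (Nat.one_lt_two_pow hm) hK
  have := finite_koblitzCurve_point (K := K)
  have hP : IsOfFinAddOrder P := isOfFinAddOrder_of_finite P
  rcases coprime_addOrderOf_or_exists_addOrderOf_eq Nat.prime_two hP N with hodd | ⟨k, hk⟩
  · exact (hper (theta_iterate_abscissa_mem_periodicPts (Nat.pos_of_ne_zero hm) hK hP hodd)).elim
  · exact le_padicValNat_add_one_of_addOrderOf_eq hm hK hk

end Curve

section AlgClosed

variable {K : Type*} [Field K]

theorem exists_sq_add_self_eq [IsAlgClosed K] (c : K) : ∃ z : K, z ^ 2 + z = c := by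
  have hdeg : (X ^ 2 + X - C c : K[X]).degree = 2 := by compute_degree!
  obtain ⟨z, hz⟩ := IsAlgClosed.exists_root _ (hdeg ▸ two_ne_zero)
  exact ⟨z, by simpa [sub_eq_zero] using hz⟩

variable [CharP K 2]

variable (K) in
/-- The subfield `{x | x ^ 2 ^ m = x}`, which has `2 ^ m` elements when `K` is algebraically closed
and `0 < m`. -/
def frobeniusFixedField (m : ℕ) : Subfield K :=
  (iterateFrobenius K 2 m).eqLocusField (RingHom.id K)

theorem mem_frobeniusFixedField {m : ℕ} {x : K} : x ∈ frobeniusFixedField K m ↔ x ^ 2 ^ m = x := by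
  rw [frobeniusFixedField, RingHom.mem_eqLocusField, iterateFrobenius_def, RingHom.id_apply]

variable [IsAlgClosed K]

theorem exists_pow_eq_and_sq_add_mul_eq {m : ℕ} {x : K} (hx0 : x ≠ 0) (hx : x ^ 2 ^ m = x)
    (htr : traceSum m (x + x⁻¹) = 0) : ∃ y : K, y ^ 2 ^ m = y ∧ y ^ 2 + x * y = x ^ 3 + 1 := by
  -- Substituting `y = x z` and dividing by `x ^ 2` puts the equation of the curve in
  -- Artin–Schreier form.
  obtain ⟨z, hz⟩ := exists_sq_add_self_eq (x + x⁻¹ ^ 2)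
  have hinv : x⁻¹ ^ 2 ^ m = x⁻¹ := by rw [inv_pow, hx]
  have hzm : z ^ 2 ^ m = z := by
    rw [← CharTwo.add_eq_zero, ← traceSum_sq_add_self, hz, traceSum_add, traceSum_sq hinv,
      ← traceSum_add, htr]
  refine ⟨x * z, by rw [mul_pow, hx, hzm], ?_⟩
  calc (x * z) ^ 2 + x * (x * z) = x ^ 2 * (z ^ 2 + z) := by ring
    _ = x ^ 3 + 1 := by
      rw [hz]
      field_simp

theorem le_padicValNat_add_one_of_traceSum_eq_zero {m : ℕ} (hm : m ≠ 0) {x : K} (hx0 : x ≠ 0)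
    (hx : x ^ 2 ^ m = x) (htr : traceSum m (x + x⁻¹) = 0) {N : ℕ}
    (hper : (theta 1)^[N] (x : OnePoint K) ∉ Function.periodicPts (theta (1 : K))) :
    N ≤ padicValNat 2 m + 1 := by
  obtain ⟨y, hy, hxy⟩ := exists_pow_eq_and_sq_add_mul_eq hx0 hx htr
  let L := frobeniusFixedField K m
  have : CharP L 2 := (algebraMap L K).charP (algebraMap L K).injective 2
  lift x to L using mem_frobeniusFixedField.mpr hx
  lift y to L using mem_frobeniusFixedField.mpr hy
  obtain ⟨P, hP⟩ := exists_abscissa_eq (x := x) (y := y) (by simpa using hx0)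
    (by exact_mod_cast hxy)
  refine le_padicValNat_add_one_of_notMem_periodicPts hm
    (fun z => Subtype.ext (mem_frobeniusFixedField.mp z.2)) P fun hmem => hper ?_
  rw [hP] at hmem
  have hsemiconj := map_theta_one L.subtype
  have hmap := hsemiconj.mapsTo_periodicPts hmem
  rwa [hsemiconj.iterate_right N] at hmap

end AlgClosed

section Degree

variable {F K : Type*} [Field F] [Field K] [Algebra F K]

theorem pow_card_pow_eq_iff_natDegree_minpoly_dvd [Finite F] {x : K} (hx : IsIntegral F x) {k : ℕ} :
    x ^ Nat.card F ^ k = x ↔ (minpoly F x).natDegree ∣ k := by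
  rw [(minpoly.irreducible hx).natDegree_dvd_iff_dvd_X_pow_card_pow_sub_X, minpoly.dvd_iff]
  simp [sub_eq_zero]

theorem natDegree_minpoly_dvd_of_mem_adjoin {y z : K} (hy : IsIntegral F y)
    (hz : z ∈ IntermediateField.adjoin F {y}) :
    (minpoly F z).natDegree ∣ (minpoly F y).natDegree := by
  have hz' : IsIntegral F z := by
    have := IntermediateField.adjoin.finiteDimensional hy
    exact (IsIntegral.of_finite F (⟨z, hz⟩ : IntermediateField.adjoin F {y})).map
      (IntermediateField.val _)
  rw [← IntermediateField.adjoin.finrank hy, ← IntermediateField.adjoin.finrank hz']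
  exact IntermediateField.finrank_dvd_of_le_right (IntermediateField.adjoin_simple_le_iff.mpr hz)

theorem natDegree_minpoly_mul {c : F} (hc : c ≠ 0) {x : K} (hx : IsIntegral F x) :
    (minpoly F (algebraMap F K c * x)).natDegree = (minpoly F x).natDegree := by
  rw [← Algebra.smul_def, IsIntegrallyClosed.minpoly_smul hc hx, natDegree_scaleRoots]

theorem eq_two_pow_succ_mul_of_dvd {d k n : ℕ} (hn : 0 < n) (hnd : n ∣ d)
    (hd : d ∣ 2 ^ (k + 1) * n) (hnot : ¬ d ∣ 2 ^ k * n) : d = 2 ^ (k + 1) * n := by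
  obtain ⟨e, rfl⟩ := hnd
  rw [mul_comm n] at hd hnot ⊢
  rw [Nat.mul_dvd_mul_iff_right hn] at hd hnot
  rw [Nat.eq_prime_pow_of_dvd_least_prime_pow Nat.prime_two hnot hd]

theorem IsTraceOne.natDegree_minpoly_eq [Finite F] [CharP K 2] {s : ℕ} (hF : Nat.card F = 2 ^ s)
    {k n : ℕ} (hn : 0 < n) {x : K} (h : IsTraceOne (s * (2 ^ (k + 1) * n)) x)
    (hx : IsIntegral F x) (hdvd : n ∣ (minpoly F x).natDegree) :
    (minpoly F x).natDegree = 2 ^ (k + 1) * n := by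
  refine eq_two_pow_succ_mul_of_dvd hn hdvd ?_ ?_ <;>
    rw [← pow_card_pow_eq_iff_natDegree_minpoly_dvd hx, hF, ← pow_mul]
  · exact h.pow_eq
  · refine pow_half_ne (m := s * (2 ^ k * n)) ?_
    convert h using 1
    ring

end Degree

section Tower

variable {K : Type*} [Field K] [CharP K 2] {x : ℕ → K}

theorem traceSum_tower_eq_zero (hx : ∀ i, theta 1 (x (i + 1) : OnePoint K) = (x i : OnePoint K))
    {m : ℕ} (h0 : x 0 ^ 2 ^ m = x 0) {i : ℕ} (hi : x (i + 1) ^ 2 ^ (2 * m) = x (i + 1)) :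
    traceSum (2 * m) (x i) = 0 := by
  induction i with
  | zero => exact traceSum_two_mul_eq_zero h0
  | succ i ih =>
    have hstep : x (i + 1) + (x (i + 1))⁻¹ = x i := (theta_one_coe_eq_coe_iff.mp (hx i)).2
    have hstep' := (theta_one_coe_eq_coe_iff.mp (hx (i + 1))).2
    have hmem : x (i + 1) ^ 2 ^ (2 * m) = x (i + 1) := by rw [← hstep', add_inv_pow_two_pow, hi]
    have hsum : traceSum (2 * m) (x (i + 1)) + traceSum (2 * m) (x (i + 1))⁻¹ = 0 := by
      rw [← traceSum_add, hstep, ih hmem]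
    have hne' : x (i + 1) ≠ 0 := (theta_one_coe_eq_coe_iff.mp (hx i)).1
    rwa [(traceSum_inv_eq_zero_iff hstep' hne' hmem).mpr hi, add_zero] at hsum

theorem isTraceOne_tower_of_pow_ne
    (hx : ∀ i, theta 1 (x (i + 1) : OnePoint K) = (x i : OnePoint K)) {m : ℕ}
    (h0 : x 0 ^ 2 ^ m = x 0) {i : ℕ} (hi : x (i + 1) ^ 2 ^ (2 * m) = x (i + 1))
    (hsucc : x (i + 2) ^ 2 ^ (2 * m) ≠ x (i + 2)) : IsTraceOne (2 * m) (x (i + 1)) := by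
  obtain ⟨hne, hstep⟩ := theta_one_coe_eq_coe_iff.mp (hx i)
  have hinv : traceSum (2 * m) (x (i + 1))⁻¹ = 1 := by
    refine (traceSum_eq_zero_or_one (by rw [inv_pow, hi])).resolve_left fun h => hsucc ?_
    exact (traceSum_inv_eq_zero_iff (theta_one_coe_eq_coe_iff.mp (hx (i + 1))).2 hne hi).mp h
  refine ⟨hi, ?_, hinv⟩
  rw [← hinv, ← CharTwo.add_eq_zero, ← traceSum_add, hstep, traceSum_tower_eq_zero hx h0 hi]

theorem IsTraceOne.tower (hx : ∀ i, theta 1 (x (i + 1) : OnePoint K) = (x i : OnePoint K))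
    {m t : ℕ} (h : IsTraceOne m (x t)) (k : ℕ) : IsTraceOne (2 ^ k * m) (x (t + k)) := by
  induction k with
  | zero => simpa using h
  | succ k ih =>
    rw [pow_succ', mul_assoc]
    exact ih.two_mul (theta_one_coe_eq_coe_iff.mp (hx (t + k))).2

variable [IsAlgClosed K]

theorem succ_le_of_tower_pow_eq (hx : ∀ i, theta 1 (x (i + 1) : OnePoint K) = (x i : OnePoint K))
    (hper : (x 1 : OnePoint K) ∉ Function.periodicPts (theta (1 : K))) {m : ℕ} (hm : m ≠ 0)
    (h0 : x 0 ^ 2 ^ m = x 0) {N : ℕ} (hN : x (N + 1) ^ 2 ^ (2 * m) = x (N + 1)) :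
    N + 1 ≤ padicValNat 2 m + 3 := by
  obtain ⟨hne, hstep⟩ := theta_one_coe_eq_coe_iff.mp (hx N)
  have hle : N ≤ padicValNat 2 (2 * m) + 1 := by
    refine le_padicValNat_add_one_of_traceSum_eq_zero (by positivity) hne hN
      (hstep ▸ traceSum_tower_eq_zero hx h0 hN) ?_
    rwa [add_comm N, theta_iterate_tower hx]
  rw [padicValNat.mul two_ne_zero hm, padicValNat_self] at hle
  omega

theorem exists_isTraceOne_tower
    (hx : ∀ i, theta 1 (x (i + 1) : OnePoint K) = (x i : OnePoint K))
    (hper : (x 1 : OnePoint K) ∉ Function.periodicPts (theta (1 : K))) {m : ℕ} (hm : m ≠ 0)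
    (h0 : x 0 ^ 2 ^ m = x 0) :
    ∃ t, 0 < t ∧ t ≤ padicValNat 2 m + 3 ∧ IsTraceOne (2 * m) (x t) := by
  obtain ⟨i, hi, hsucc⟩ : ∃ i, x (i + 1) ^ 2 ^ (2 * m) = x (i + 1) ∧
      x (i + 2) ^ 2 ^ (2 * m) ≠ x (i + 2) := by
    by_contra! hstay
    have hmem (i : ℕ) : x (i + 1) ^ 2 ^ (2 * m) = x (i + 1) := by
      induction i with
      | zero =>
        refine pow_two_pow_two_mul_eq ?_
        rw [(theta_one_coe_eq_coe_iff.mp (hx 0)).2, h0]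
      | succ i ih => exact hstay i ih
    have := succ_le_of_tower_pow_eq hx hper hm h0 (hmem (padicValNat 2 m + 3))
    omega
  exact ⟨i + 1, i.succ_pos, succ_le_of_tower_pow_eq hx hper hm h0 hi,
    isTraceOne_tower_of_pow_ne hx h0 hi hsucc⟩

end Tower

section TowerDegree

variable {F K : Type*} [Field F] [Field K] [Algebra F K]

theorem natDegree_minpoly_dvd_of_theta_eq {a : F} {y z : K} (hy : IsIntegral F y)
    (h : theta (algebraMap F K a) (y : OnePoint K) = (z : OnePoint K)) :
    (minpoly F z).natDegree ∣ (minpoly F y).natDegree := by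
  rw [← (theta_coe_eq_coe_iff.mp h).2]
  have hmem := IntermediateField.mem_adjoin_simple_self F y
  exact natDegree_minpoly_dvd_of_mem_adjoin hy
    (add_mem hmem (mul_mem (IntermediateField.algebraMap_mem _ a) (inv_mem hmem)))

variable [Finite F] [CharP K 2] [IsAlgClosed K] [Algebra.IsAlgebraic F K] {s : ℕ} {x : ℕ → K}

theorem exists_natDegree_minpoly_theta_one_tower_eq (hF : Nat.card F = 2 ^ s)
    (hx : ∀ i, theta 1 (x (i + 1) : OnePoint K) = (x i : OnePoint K))
    (hper : (x 1 : OnePoint K) ∉ Function.periodicPts (theta (1 : K))) :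
    ∃ t, 0 < t ∧ t ≤ padicValNat 2 s + padicValNat 2 (minpoly F (x 0)).natDegree + 3 ∧
      ∀ k, (minpoly F (x (t + k))).natDegree = 2 ^ (k + 1) * (minpoly F (x 0)).natDegree := by
  have hint (i : ℕ) : IsIntegral F (x i) := Algebra.IsIntegral.isIntegral (x i)
  set n := (minpoly F (x 0)).natDegree
  have hn : 0 < n := minpoly.natDegree_pos (hint 0)
  have hs : s ≠ 0 := by
    rintro rfl
    exact (Finite.one_lt_card (α := F)).ne' hF
  have h0 : x 0 ^ 2 ^ (s * n) = x 0 := by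
    rw [pow_mul, ← hF, pow_card_pow_eq_iff_natDegree_minpoly_dvd (hint 0)]
  have hdvd (i : ℕ) : n ∣ (minpoly F (x i)).natDegree := by
    induction i with
    | zero => exact dvd_rfl
    | succ i ih =>
      exact ih.trans (natDegree_minpoly_dvd_of_theta_eq (a := 1) (hint _) (by rw [map_one, hx i]))
  obtain ⟨t, ht0, ht, htr⟩ := exists_isTraceOne_tower hx hper (mul_ne_zero hs hn.ne') h0
  rw [padicValNat.mul hs hn.ne'] at ht
  refine ⟨t, ht0, ht, fun k => IsTraceOne.natDegree_minpoly_eq hF hn ?_ (hint _) (hdvd _)⟩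
  convert htr.tower hx k using 1
  ring

theorem exists_natDegree_minpoly_tower_eq (hF : Nat.card F = 2 ^ s) {α : F} (hα : α ≠ 0)
    (hx : ∀ i, theta (algebraMap F K α) (x (i + 1) : OnePoint K) = (x i : OnePoint K))
    (hper : (x 1 : OnePoint K) ∉ Function.periodicPts (theta (algebraMap F K α))) :
    ∃ t, 0 < t ∧ t ≤ padicValNat 2 s + padicValNat 2 (minpoly F (x 0)).natDegree + 3 ∧
      ∀ k, (minpoly F (x (t + k))).natDegree = 2 ^ (k + 1) * (minpoly F (x 0)).natDegree := by
  have : CharP F 2 := (algebraMap F K).charP (algebraMap F K).injective 2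
  obtain ⟨c, hc⟩ := surjective_frobenius F 2 α⁻¹
  have hc0 : c ≠ 0 := by
    rintro rfl
    exact inv_ne_zero hα (hc.symm.trans (map_zero _))
  have hγ : algebraMap F K c ≠ 0 := by simpa using hc0
  have hscale := map_mul_theta hγ (algebraMap F K α)
  rw [← map_pow, ← map_mul, ← frobenius_def, hc, inv_mul_cancel₀ hα, map_one] at hscale
  let y (i : ℕ) : K := algebraMap F K c * x i
  have hy (i : ℕ) : theta 1 (y (i + 1) : OnePoint K) = (y i : OnePoint K) :=
    (hscale _).symm.trans (congrArg _ (hx i))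
  have hyper : (y 1 : OnePoint K) ∉ Function.periodicPts (theta (1 : K)) := fun hmem => hper <|
    mem_periodicPts_of_semiconj_of_injective (Option.map_injective (mul_right_injective₀ hγ))
      hscale hmem
  simpa only [y, natDegree_minpoly_mul hc0 (Algebra.IsIntegral.isIntegral (x _))] using
    exists_natDegree_minpoly_theta_one_tower_eq hF hy hyper

end TowerDegree

section QTransform

variable {F : Type*} [Field F]

theorem natDegree_qTransform_le (a : F) (f : F[X]) :
    (qTransform a f).natDegree ≤ 2 * f.natDegree := by
  refine natDegree_sum_le_of_forall_le _ _ fun k hk => ?_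
  have hterm : (C (f.coeff k) * (X ^ 2 + C a) ^ k * X ^ (f.natDegree - k)).natDegree ≤
      k * 2 + (f.natDegree - k) := by
    compute_degree
  have hk' : k ≤ f.natDegree := le_natDegree_of_mem_supp k hk
  exact hterm.trans (by omega)

theorem aeval_qTransform {K : Type*} [Field K] [Algebra F K] (a : F) (f : F[X]) {x : K}
    (hx : x ≠ 0) : aeval x (qTransform a f) =
      x ^ f.natDegree * aeval (x + algebraMap F K a * x⁻¹) f := by
  rw [aeval_eq_sum_range' (p := f) (Nat.lt_succ_self _), qTransform, sum_over_range _ (by simp),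
    map_sum, Finset.mul_sum]
  refine Finset.sum_congr rfl fun k hk => ?_
  obtain ⟨r, hr⟩ := Nat.exists_eq_add_of_le (Nat.lt_succ_iff.mp (Finset.mem_range.mp hk))
  have hfactor : x ^ 2 + algebraMap F K a = x * (x + algebraMap F K a * x⁻¹) := by field_simp
  simp only [map_mul, map_pow, map_add, aeval_C, aeval_X]
  rw [hfactor, mul_pow, hr, Nat.add_sub_cancel_left, pow_add, Algebra.smul_def]
  ring

theorem eval_zero_qTransform (a : F) (f : F[X]) :
    (qTransform a f).eval 0 = f.leadingCoeff * a ^ f.natDegree := by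
  rw [qTransform, sum_over_range _ (by simp), eval_finsetSum,
    Finset.sum_eq_single_of_mem f.natDegree (by simp)]
  · simp
  · intro k hk hne
    have : f.natDegree - k ≠ 0 := by
      have := Finset.mem_range.mp hk
      omega
    simp [this]

theorem eval_zero_qTransform_ne_zero {a : F} (ha : a ≠ 0) {f : F[X]} (hf : f ≠ 0) :
    (qTransform a f).eval 0 ≠ 0 := by
  rw [eval_zero_qTransform]
  exact mul_ne_zero (leadingCoeff_ne_zero.mpr hf) (pow_ne_zero _ ha)

theorem irreducible_qTransform_of_dvd {a : F} (ha : a ≠ 0) {f g : F[X]} (hf : f ≠ 0)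
    (hg : Irreducible g) (hdvd : g ∣ qTransform a f) (hdeg : g.natDegree = 2 * f.natDegree) :
    Irreducible (qTransform a f) := by
  have hne : qTransform a f ≠ 0 := fun h => eval_zero_qTransform_ne_zero ha hf (by simp [h])
  have hle : (qTransform a f).natDegree ≤ g.natDegree := hdeg ▸ natDegree_qTransform_le a f
  exact (associated_of_dvd_of_natDegree_le hdvd hne hle).irreducible hg

variable {K : Type*} [Field K] [Algebra F K]

theorem exists_theta_eq_of_dvd_qTransform {a : F} (ha : a ≠ 0) {f g : F[X]} (hf : f ≠ 0)
    (hdvd : g ∣ qTransform a f) {y : K} (hy : aeval y g = 0) :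
    ∃ z : K, aeval z f = 0 ∧ theta (algebraMap F K a) (y : OnePoint K) = (z : OnePoint K) := by
  have hroot : aeval y (qTransform a f) = 0 := aeval_eq_zero_of_dvd_aeval_eq_zero hdvd hy
  have hy0 : y ≠ 0 := by
    rintro rfl
    rw [← map_zero (algebraMap F K), aeval_algebraMap_apply_eq_algebraMap_eval] at hroot
    exact eval_zero_qTransform_ne_zero ha hf ((algebraMap F K).injective hroot)
  rw [aeval_qTransform a f hy0] at hroot
  exact ⟨_, (mul_eq_zero.mp hroot).resolve_left (pow_ne_zero _ hy0), theta_coe _ hy0⟩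

theorem exists_root_theta_eq [IsAlgClosed K] [Algebra.IsAlgebraic F K] {a : F} (ha : a ≠ 0)
    {f g : F[X]} (hf : Irreducible f) (hg : Irreducible g) (hdvd : g ∣ qTransform a f) {z : K}
    (hz : aeval z f = 0) :
    ∃ y : K, aeval y g = 0 ∧ theta (algebraMap F K a) (y : OnePoint K) = (z : OnePoint K) := by
  obtain ⟨y, hy⟩ := IsAlgClosed.exists_aeval_eq_zero K g hg.degree_pos.ne'
  obtain ⟨w, hw, hyw⟩ := exists_theta_eq_of_dvd_qTransform ha hf.ne_zero hdvd hy
  have hconj : IsConjRoot F w z := by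
    rw [isConjRoot_def, ← minpoly.eq_of_irreducible hf hw, ← minpoly.eq_of_irreducible hf hz]
  have : IsAlgClosure F K := ⟨inferInstance, inferInstance⟩
  obtain ⟨σ, rfl⟩ := hconj.symm.exists_algEquiv
  refine ⟨σ y, by rw [aeval_algHom_apply, hy, map_zero], ?_⟩
  have h := map_theta (σ : K →+* K) (algebraMap F K a) y
  rw [hyw] at h
  simpa using h.symm

theorem exists_root_tower [IsAlgClosed K] [Algebra.IsAlgebraic F K] {a : F} (ha : a ≠ 0)
    {f : ℕ → F[X]} (hirr : ∀ i, Irreducible (f i)) (hdvd : ∀ i, f (i + 1) ∣ qTransform a (f i)) :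
    ∃ x : ℕ → K, (∀ i, aeval (x i) (f i) = 0) ∧
      ∀ i, theta (algebraMap F K a) (x (i + 1) : OnePoint K) = (x i : OnePoint K) := by
  obtain ⟨x₀, hx₀⟩ := IsAlgClosed.exists_aeval_eq_zero K (f 0) (hirr 0).degree_pos.ne'
  have hnext (i : ℕ) (z : { z : K // aeval z (f i) = 0 }) :
      ∃ y : { y : K // aeval y (f (i + 1)) = 0 },
        theta (algebraMap F K a) (y : OnePoint K) = ((z : K) : OnePoint K) := by
    obtain ⟨y, hy, hyz⟩ := exists_root_theta_eq ha (hirr i) (hirr (i + 1)) (hdvd i) z.2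
    exact ⟨⟨y, hy⟩, hyz⟩
  choose next hnext using hnext
  let x : (i : ℕ) → { z : K // aeval z (f i) = 0 } := Nat.rec ⟨x₀, hx₀⟩ next
  exact ⟨fun i => (x i).1, fun i => (x i).2, fun i => hnext i (x i)⟩

end QTransform

theorem theorem3p2 {F : Type*} [Field F] [Finite F] (s n : ℕ) (hs : 0 < s)
    (hF : Nat.card F = 2 ^ s) (α : F) (hα : α ≠ 0) (f : ℕ → F[X])
    (hmonic : ∀ i, (f i).Monic) (hirr : ∀ i, Irreducible (f i)) (hn : (f 0).natDegree = n)
    (hdvd : ∀ i, f (i + 1) ∣ qTransform α (f i))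
    (hper : ∀ β : AlgebraicClosure F, aeval β (f 1) = 0 →
      (β : OnePoint (AlgebraicClosure F)) ∉
        Function.periodicPts (theta (algebraMap F (AlgebraicClosure F) α))) :
    ∃ t : ℕ, 0 < t ∧ t ≤ padicValNat 2 s + padicValNat 2 n + 3 ∧
      (f t).natDegree = 2 * n ∧ (f (t + 1)).natDegree = 4 * n ∧
      ∀ i, t ≤ i → Irreducible (qTransform α (f i)) ∧
        (f (i + 1)).natDegree = 2 * (f i).natDegree := by
  have := Fintype.ofFinite F
  have : CharP F 2 := charP_of_card_eq_prime_pow (f := s) (by rw [← Nat.card_eq_fintype_card, hF])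
  have : CharP (AlgebraicClosure F) 2 :=
    charP_of_injective_algebraMap (algebraMap F (AlgebraicClosure F)).injective 2
  obtain ⟨x, hroot, hx⟩ := exists_root_tower (K := AlgebraicClosure F) hα hirr hdvd
  obtain ⟨t, ht0, ht, hdeg⟩ := exists_natDegree_minpoly_tower_eq hF hα hx (hper _ (hroot 1))
  simp only [← minpoly.eq_of_irreducible_of_monic (hirr _) (hroot _) (hmonic _), hn] at ht hdeg
  have hdouble (i : ℕ) (hi : t ≤ i) : (f (i + 1)).natDegree = 2 * (f i).natDegree := by
    obtain ⟨k, rfl⟩ := Nat.exists_eq_add_of_le hi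
    rw [add_assoc, hdeg, hdeg, pow_succ', mul_assoc]
  refine ⟨t, ht0, ht, hdeg 0, hdeg 1, fun i hi => ⟨?_, hdouble i hi⟩⟩
  exact irreducible_qTransform_of_dvd hα (hirr i).ne_zero (hirr (i + 1)) (hdvd i) (hdouble i hi)
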